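/- Let $n,p\ge 1$, $s\in\{1,\dots,p\}$, $\sigma>0$, $\mathbb X\in\mathbb R^{n\times p}$, and let $\xi\sim\mathcal N(0,\sigma^2 I_{n\times n})$. Write $\|u\|_n^2=\frac1n\sum_{i=1}^n u_i^2$ for $u\in\mathbb R^n$, $|\beta|_q=(\sum_{j=1}^p|\beta_j|^q)^{1/q}$ for $q\ge 1$, and $|\beta|_0$ for the number of nonzero entries of $\beta\in\mathbb R^p$. For $c_0>0$ put $$\theta(s,c_0)=\min\Big\{\frac{\|\mathbb X\delta\|_n}{|\delta|_2}:\ \delta\in\mathbb R^p\setminus\{0\},\ |\delta|_1\le(1+c_0)\sqrt s\,|\delta|_2\Big\}.$$ Condition $SRE(s,c_0)$ means that $\|\mathbb Xe_j\|_n\le1$ for every canonical basis vector $e_j$ of $\mathbb R^p$ and that $\theta(s,c_0)>0$. Assume $SRE(s,7)$ and let $\lambda\ge 2(4+\sqrt2)\,\sigma\sqrt{\log(2ep/s)/n}$. For $f\in\mathbb R^n$ let $\hat\beta$ denote a Lasso estimator based on $y=f+\xi$, i.e. any minimizer over $\beta\in\mathbb R^p$ of $\|\mathbb X\beta-y\|_n^2+2\lambda|\beta|_1$.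 Then there is an event of probability at least $$1-\frac12\Big(\frac{s}{2ep}\Big)^{s/\theta^2(s,7)}$$ on which, simultaneously for all $f\in\mathbb R^n$ and all Lasso estimators $\hat\beta$ based on $y=f+\xi$, the following hold. (i) For all $\beta\in\mathbb R^p$ with $|\beta|_0\le s$, $$\frac\lambda2|\hat\beta-\beta|_1+\|\mathbb X\hat\beta-f\|_n^2\le\|\mathbb X\beta-f\|_n^2+\frac{49\lambda^2s}{16\,\theta^2(s,7)}.$$ (ii) If $f=\mathbb X\beta^*$ for some $\beta^*\in\mathbb R^p$ with $|\beta^*|_0\le s$, then for all $q\in[1,2]$, $$|\hat\beta-\beta^*|_q\le\frac{49\,\lambda\,s^{1/q}}{8\,\theta^2(s,7)}.$$ -/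

import Mathlib

open MeasureTheory ProbabilityTheory
open scoped Matrix

/-- The empirical norm `‖u‖_n = ((1/n) ∑ u_i²)^{1/2}` on `ℝⁿ`. -/
noncomputable def empNorm {n : ℕ} (u : Fin n → ℝ) : ℝ :=
  Real.sqrt ((1 / (n : ℝ)) * ∑ i, u i ^ 2)

/-- The `ℓ_q` norm `|β|_q = (∑ |β_j|^q)^{1/q}` on `ℝᵖ`, used for real `q` with `1 ≤ q`. -/
noncomputable def lqNorm {p : ℕ} (q : ℝ) (β : Fin p → ℝ) : ℝ :=
  (∑ j, |β j| ^ q) ^ (1 / q)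

/-- `βh` is a Lasso estimator with tuning parameter `lam` for the design matrix `X` and the
observation `y`: a global minimizer of `β ↦ ‖Xβ - y‖_n² + 2 lam |β|_1`. -/
def IsLasso {n p : ℕ} (X : Matrix (Fin n) (Fin p) ℝ) (lam : ℝ) (y : Fin n → ℝ)
    (βh : Fin p → ℝ) : Prop :=
  ∀ β : Fin p → ℝ,
    empNorm (X *ᵥ βh - y) ^ 2 + 2 * lam * lqNorm 1 βh ≤
      empNorm (X *ᵥ β - y) ^ 2 + 2 * lam * lqNorm 1 β

/-- The cone `{δ : |δ|_1 ≤ (1 + c₀) √s |δ|_2}`. -/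
def sreCone (p s : ℕ) (c₀ : ℝ) : Set (Fin p → ℝ) :=
  {δ | lqNorm 1 δ ≤ (1 + c₀) * Real.sqrt s * lqNorm 2 δ}

/-- The constant `θ(s, c₀)`: the infimum of `‖Xδ‖_n / |δ|_2` over the nonzero vectors `δ` of
the cone. For `1 ≤ s ≤ p` and `0 < c₀` these vectors exist and the infimum is a minimum. -/
noncomputable def sreTheta {n p : ℕ} (X : Matrix (Fin n) (Fin p) ℝ) (s : ℕ) (c₀ : ℝ) : ℝ :=
  sInf ((fun δ : Fin p → ℝ => empNorm (X *ᵥ δ) / lqNorm 2 δ) '' {δ | δ ∈ sreCone p s c₀ ∧ δ ≠ 0})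

/-- The Strong Restricted Eigenvalue condition `SRE(s, c₀)`: the columns `X e_j` have empirical
norm at most one, and `θ(s, c₀) > 0`. -/
def SRE {n p : ℕ} (X : Matrix (Fin n) (Fin p) ℝ) (s : ℕ) (c₀ : ℝ) : Prop :=
  (∀ j : Fin p, empNorm (X *ᵥ Pi.single j 1) ≤ 1) ∧ 0 < sreTheta X s c₀

/-! ### Gaussian concentration by rotation -/

section Concentration

variable {E : Type*} [NormedAddCommGroup E] [InnerProductSpace ℝ E] [FiniteDimensional ℝ E]
  [MeasurableSpace E] [BorelSpace E] {μ : Measure E} [IsGaussian μ]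

/-! The good event constrains the noise alone: it bounds ⟨ξ, Xu⟩/n for all u at once. Everything
after that is deterministic, which gives uniformity in f, β and the minimizer.

Noise. Let G be the set of vectors whose correlations with the columns of X obey an
exponential-square bound; G has probability at least 1/2. With l = (s/θ²) log(2ep/s), concentration
around G (`measure_mul_measure_le_infDist_le`) gives, outside probability e^{-l}/2, a splitting ξ =
v + w with v in G and ‖w‖ ≤ πσ√l. On G any s squared correlations have a small sum, so a
rearrangement argument (`sum_mul_le_of_sum_sq_le`) controls ⟨v, Xu⟩ by √s|u|_2 plus the ℓ1 mass of u
outside a set T of size s. Cauchy-Schwarz controls ⟨w, Xu⟩ by (√s/θ)‖Xu‖_n. The two constants √(8/3)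
and π fit into 4 + √2, so λ dominates the noise (`noise_le`).

Lasso. Put u = βh - β. First order optimality leaves a term -‖Xu‖_n². Either u lies in the cone with
c₀ = 7, where θ turns |u|_2 into ‖Xu‖_n and the remainder, linear in ‖Xu‖_n, is absorbed by the
square; or the penalty outweighs the noise and the remainder is nonpositive (`lasso_remainder_le`).
When f = Xβ*, this bounds |u|_1 and |u|_2, and interpolation covers q in [1, 2]. -/

theorem lintegral_exp_dual_le (hμ : μ[id] = 0) {σ : ℝ}
    (hσ : ∀ L : StrongDual ℝ E, Var[L; μ] ≤ σ ^ 2 * ‖L‖ ^ 2) (L : StrongDual ℝ E) (c : ℝ) :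
    ∫⁻ y, ENNReal.ofReal (Real.exp (c * L y)) ∂μ ≤
      ENNReal.ofReal (Real.exp (σ ^ 2 * ‖L‖ ^ 2 * c ^ 2 / 2)) := by
  have h1 : μ[L] = 0 := by
    rw [IsGaussian.integral_dual]
    simp only [id_eq] at hμ
    simp [hμ]
  have hmap := IsGaussian.map_eq_gaussianReal (μ := μ) L
  rw [h1] at hmap
  have hint : Integrable (fun y => Real.exp (c * L y)) μ := by
    have := integrable_exp_mul_gaussianReal (μ := 0) (v := Var[L; μ].toNNReal) c
    rw [← hmap] at this
    exact this.comp_measurable (by fun_prop)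
  rw [← ofReal_integral_eq_lintegral_ofReal hint
    (Filter.Eventually.of_forall fun _ => (Real.exp_pos _).le)]
  apply ENNReal.ofReal_le_ofReal
  have := mgf_gaussianReal hmap c
  rw [mgf] at this
  rw [this, Real.exp_le_exp, Real.coe_toNNReal _ (variance_nonneg _ _)]
  nlinarith [hσ L, sq_nonneg c, mul_le_mul_of_nonneg_right (hσ L) (sq_nonneg c)]

omit [FiniteDimensional ℝ E] [MeasurableSpace E] [BorelSpace E] in
-- Integrate the derivative of F along the quarter circle from x to y. The integral is π/2 times a
-- mean over [0, π/2], and Jensen moves `exp` inside that mean.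
theorem exp_sub_le_average {F : E → ℝ} (hF : ContDiff ℝ 1 F) (c : ℝ) (x y : E) :
    Real.exp (c * (F y - F x)) ≤ 2 / Real.pi * ∫ θ in (0 : ℝ)..(Real.pi / 2),
      Real.exp (c * (Real.pi / 2) * fderiv ℝ F (Real.cos θ • x + Real.sin θ • y)
        (-Real.sin θ • x + Real.cos θ • y)) := by
  have hpi := Real.pi_pos
  set h : ℝ → ℝ := fun θ => fderiv ℝ F (Real.cos θ • x + Real.sin θ • y)
        (-Real.sin θ • x + Real.cos θ • y) with hh
  have hcont : Continuous h := by
    have := hF.continuous_fderiv one_ne_zero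
    fun_prop
  have hder : ∀ θ, HasDerivAt (fun θ => F (Real.cos θ • x + Real.sin θ • y)) (h θ) θ := by
    intro θ
    have h1 : HasDerivAt (fun θ => Real.cos θ • x + Real.sin θ • y)
        (-Real.sin θ • x + Real.cos θ • y) θ :=
      ((Real.hasDerivAt_cos θ).smul_const x).add ((Real.hasDerivAt_sin θ).smul_const y)
    exact ((hF.differentiable one_ne_zero _).hasFDerivAt).comp_hasDerivAt θ h1
  have hFTC : ∫ θ in (0 : ℝ)..(Real.pi / 2), h θ = F y - F x := by
    rw [intervalIntegral.integral_eq_sub_of_hasDerivAt (fun θ _ => hder θ)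
      (hcont.intervalIntegrable _ _)]
    simp
  have : NeZero (volume.restrict (Set.Ioc 0 (Real.pi / 2))) := ⟨by
    rw [Ne, Measure.restrict_eq_zero, Real.volume_Ioc]
    simpa using hpi⟩
  have hJ := convexOn_exp.map_average_le (μ := volume.restrict (Set.Ioc 0 (Real.pi / 2)))
    (f := fun θ => c * (Real.pi / 2) * h θ) Real.continuous_exp.continuousOn isClosed_univ
    (by simp) ((by fun_prop : Continuous fun θ => c * (Real.pi / 2) * h θ).integrableOn_Ioc)
    ((by fun_prop : Continuous (Real.exp ∘ fun θ => c * (Real.pi / 2) * h θ)).integrableOn_Ioc)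
  simp only [average_eq, measureReal_restrict_apply_univ, Real.volume_real_Ioc, sub_zero,
    smul_eq_mul, max_eq_left (show 0 ≤ Real.pi / 2 by positivity),
    ← intervalIntegral.integral_of_le (show 0 ≤ Real.pi / 2 by positivity)] at hJ
  rw [intervalIntegral.integral_const_mul, hFTC] at hJ
  have e1 : (Real.pi / 2)⁻¹ * (c * (Real.pi / 2) * (F y - F x)) = c * (F y - F x) := by
    field_simp
  rw [e1, inv_div] at hJ
  exact hJ

/-- A rotation preserves μ ⊗ μ, so at each angle position and velocity on the arc are again
independent copies of μ. Given the position, the derivative of F is a centered Gaussian in the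
velocity, of variance at most σ²; the factor cπ/2 gives the exponent. -/
theorem lintegral_exp_sub_le_of_contDiff (hμ : μ[id] = 0) {σ : ℝ}
    (hσ : ∀ L : StrongDual ℝ E, Var[L; μ] ≤ σ ^ 2 * ‖L‖ ^ 2) {F : E → ℝ}
    (hF : ContDiff ℝ 1 F) (hL : LipschitzWith 1 F) (c : ℝ) :
    ∫⁻ z, ENNReal.ofReal (Real.exp (c * (F z.1 - F z.2))) ∂(μ.prod μ) ≤
      ENNReal.ofReal (Real.exp (σ ^ 2 * Real.pi ^ 2 * c ^ 2 / 8)) := by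
  have hpi := Real.pi_pos
  have hfd := hF.continuous_fderiv one_ne_zero
  set G : E × E → ENNReal := fun z =>
    ENNReal.ofReal (Real.exp (-c * (Real.pi / 2) * fderiv ℝ F z.1 z.2)) with hG
  have hGc : Measurable G := by
    have : Continuous fun z : E × E => fderiv ℝ F z.1 z.2 := by fun_prop
    exact (ENNReal.continuous_ofReal.comp (by fun_prop : Continuous fun z : E × E =>
      Real.exp (-c * (Real.pi / 2) * fderiv ℝ F z.1 z.2))).measurable
  have hGint : ∫⁻ z, G z ∂(μ.prod μ) ≤
      ENNReal.ofReal (Real.exp (σ ^ 2 * Real.pi ^ 2 * c ^ 2 / 8)) := by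
    rw [lintegral_prod _ hGc.aemeasurable]
    have : ∀ x, ∫⁻ y, G (x, y) ∂μ ≤
        ENNReal.ofReal (Real.exp (σ ^ 2 * Real.pi ^ 2 * c ^ 2 / 8)) := by
      intro x
      refine (lintegral_exp_dual_le hμ hσ (fderiv ℝ F x) (-c * (Real.pi / 2))).trans ?_
      apply ENNReal.ofReal_le_ofReal
      rw [Real.exp_le_exp]
      have h1 : ‖fderiv ℝ F x‖ ≤ 1 := by simpa using norm_fderiv_le_of_lipschitz ℝ hL
      have h2 : ‖fderiv ℝ F x‖ ^ 2 ≤ 1 := pow_le_one₀ (norm_nonneg _) h1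
      have h3 : 0 ≤ σ ^ 2 * Real.pi ^ 2 * c ^ 2 / 8 := by positivity
      calc σ ^ 2 * ‖fderiv ℝ F x‖ ^ 2 * (-c * (Real.pi / 2)) ^ 2 / 2
          = σ ^ 2 * Real.pi ^ 2 * c ^ 2 / 8 * ‖fderiv ℝ F x‖ ^ 2 := by ring
        _ ≤ σ ^ 2 * Real.pi ^ 2 * c ^ 2 / 8 := mul_le_of_le_one_right h3 h2
    calc ∫⁻ x, ∫⁻ y, G (x, y) ∂μ ∂μ ≤
        ∫⁻ x, ENNReal.ofReal (Real.exp (σ ^ 2 * Real.pi ^ 2 * c ^ 2 / 8)) ∂μ :=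
          lintegral_mono this
      _ = _ := by simp
  have hpt : ∀ z : E × E, ENNReal.ofReal (Real.exp (c * (F z.1 - F z.2))) ≤
      ENNReal.ofReal (2 / Real.pi) *
        ∫⁻ θ in Set.Ioc 0 (Real.pi / 2), G (ContinuousLinearMap.rotation θ z) := by
    intro z
    have h1 := exp_sub_le_average hF (-c) z.1 z.2
    have hcont : Continuous fun θ : ℝ => Real.exp (-c * (Real.pi / 2) *
        fderiv ℝ F (Real.cos θ • z.1 + Real.sin θ • z.2)
          (-Real.sin θ • z.1 + Real.cos θ • z.2)) := by fun_prop
    rw [show -c * (F z.2 - F z.1) = c * (F z.1 - F z.2) by ring] at h1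
    refine (ENNReal.ofReal_le_ofReal h1).trans_eq ?_
    rw [ENNReal.ofReal_mul (by positivity), intervalIntegral.integral_of_le (by positivity),
      ofReal_integral_eq_lintegral_ofReal hcont.integrableOn_Ioc
        (Filter.Eventually.of_forall fun _ => (Real.exp_pos _).le)]
    simp only [hG, ContinuousLinearMap.rotation_apply]
  have hmeas : Measurable fun q : (E × E) × ℝ => G (ContinuousLinearMap.rotation q.2 q.1) := by
    have : Continuous fun q : (E × E) × ℝ => ContinuousLinearMap.rotation q.2 q.1 := by
      simp only [ContinuousLinearMap.rotation_apply]
      fun_prop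
    exact hGc.comp this.measurable
  calc ∫⁻ z, ENNReal.ofReal (Real.exp (c * (F z.1 - F z.2))) ∂(μ.prod μ)
      ≤ ∫⁻ z, ENNReal.ofReal (2 / Real.pi) *
        (∫⁻ θ in Set.Ioc 0 (Real.pi / 2), G (ContinuousLinearMap.rotation θ z)) ∂(μ.prod μ) :=
        lintegral_mono hpt
    _ = ENNReal.ofReal (2 / Real.pi) * ∫⁻ θ in Set.Ioc 0 (Real.pi / 2),
        ∫⁻ z, G (ContinuousLinearMap.rotation θ z) ∂(μ.prod μ) := by
        rw [lintegral_const_mul _ hmeas.lintegral_prod_right', lintegral_lintegral_swap]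
        exact hmeas.aemeasurable
    _ = ENNReal.ofReal (2 / Real.pi) * ∫⁻ θ in Set.Ioc 0 (Real.pi / 2),
        ∫⁻ z, G z ∂(μ.prod μ) := by
        refine congrArg _ (lintegral_congr fun θ => ?_)
        conv_rhs => rw [← IsGaussian.map_rotation_eq_self hμ θ]
        rw [lintegral_map hGc (by fun_prop)]
    _ = ∫⁻ z, G z ∂(μ.prod μ) := by
        rw [setLIntegral_const, Real.volume_Ioc, sub_zero, mul_comm (lintegral _ _), ← mul_assoc,
          ← ENNReal.ofReal_mul (by positivity)]
        rw [show 2 / Real.pi * (Real.pi / 2) = 1 by field_simp]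
        simp
    _ ≤ _ := hGint

/-- Mollification: averaging translates of F keeps the Lipschitz constant, and a bump supported in
the ε-ball moves F by at most ε. This opens the smooth estimate to distance functions. -/
theorem exists_contDiff_lipschitzWith_near {F : E → ℝ} (hF : LipschitzWith 1 F) {ε : ℝ}
    (hε : 0 < ε) :
    ∃ G : E → ℝ, ContDiff ℝ 1 G ∧ LipschitzWith 1 G ∧ ∀ x, |G x - F x| ≤ ε := by
  let φ : ContDiffBump (0 : E) := ⟨ε / 2, ε, by positivity, by linarith⟩
  have hconv : ∀ x, ConvolutionExistsAt (φ.normed volume) F x (ContinuousLinearMap.lsmul ℝ ℝ)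
      volume := fun x => φ.hasCompactSupport_normed.convolutionExists_left _
        φ.continuous_normed hF.continuous.locallyIntegrable x
  refine ⟨convolution (φ.normed volume) F (ContinuousLinearMap.lsmul ℝ ℝ) volume,
    φ.hasCompactSupport_normed.contDiff_convolution_left _ φ.contDiff_normed
      hF.continuous.locallyIntegrable, ?_, ?_⟩
  · refine LipschitzWith.of_dist_le_mul fun x y => ?_
    rw [dist_eq_norm, convolution, convolution, ← integral_sub (hconv x) (hconv y)]
    calc ‖∫ a, ContinuousLinearMap.lsmul ℝ ℝ (φ.normed volume a) (F (x - a)) -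
            ContinuousLinearMap.lsmul ℝ ℝ (φ.normed volume a) (F (y - a))‖
        ≤ ∫ a, φ.normed volume a * dist x y := by
          refine norm_integral_le_of_norm_le (φ.integrable_normed.mul_const _)
            (Filter.Eventually.of_forall fun a => ?_)
          simp only [ContinuousLinearMap.lsmul_apply, smul_eq_mul]
          rw [← mul_sub, norm_mul, Real.norm_of_nonneg (φ.nonneg_normed a)]
          refine mul_le_mul_of_nonneg_left ?_ (φ.nonneg_normed a)
          have := hF.dist_le_mul (x - a) (y - a)
          simpa [dist_eq_norm] using this
      _ = ((1 : NNReal) : ℝ) * dist x y := by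
          rw [integral_mul_const, φ.integral_normed]; simp
  · intro x
    have := φ.dist_normed_convolution_le (μ := volume) (g := F) (x₀ := x) (ε := ε)
      hF.continuous.aestronglyMeasurable (fun y hy => by
        have h1 := hF.dist_le_mul y x
        have h2 : dist y x < ε := hy
        simp at h1
        linarith)
    simpa [Real.dist_eq] using this

theorem lintegral_exp_sub_le_of_lipschitz (hμ : μ[id] = 0) {σ : ℝ}
    (hσ : ∀ L : StrongDual ℝ E, Var[L; μ] ≤ σ ^ 2 * ‖L‖ ^ 2) {F : E → ℝ}
    (hL : LipschitzWith 1 F) (c : ℝ) :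
    ∫⁻ z, ENNReal.ofReal (Real.exp (c * (F z.1 - F z.2))) ∂(μ.prod μ) ≤
      ENNReal.ofReal (Real.exp (σ ^ 2 * Real.pi ^ 2 * c ^ 2 / 8)) := by
  have key : ∀ ε : ℝ, 0 < ε →
      ∫⁻ z, ENNReal.ofReal (Real.exp (c * (F z.1 - F z.2))) ∂(μ.prod μ) ≤
      ENNReal.ofReal (Real.exp (2 * |c| * ε + σ ^ 2 * Real.pi ^ 2 * c ^ 2 / 8)) := by
    intro ε hε
    obtain ⟨G, hG1, hG2, hG3⟩ := exists_contDiff_lipschitzWith_near hL hε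
    calc _ ≤ ∫⁻ z, ENNReal.ofReal (Real.exp (2 * |c| * ε)) *
          ENNReal.ofReal (Real.exp (c * (G z.1 - G z.2))) ∂(μ.prod μ) := by
          refine lintegral_mono fun z => ?_
          rw [← ENNReal.ofReal_mul (Real.exp_pos _).le, ← Real.exp_add]
          apply ENNReal.ofReal_le_ofReal
          rw [Real.exp_le_exp]
          have h1 : c * ((F z.1 - F z.2) - (G z.1 - G z.2)) ≤ |c| * (2 * ε) := by
            refine (le_abs_self _).trans ?_
            rw [abs_mul]
            refine mul_le_mul_of_nonneg_left ?_ (abs_nonneg _)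
            have := abs_le.1 (hG3 z.1)
            have := abs_le.1 (hG3 z.2)
            rw [abs_le]; constructor <;> linarith
          linarith
      _ ≤ _ := by
          rw [lintegral_const_mul' _ _ ENNReal.ofReal_ne_top, Real.exp_add,
            ENNReal.ofReal_mul (Real.exp_pos _).le]
          gcongr
          exact lintegral_exp_sub_le_of_contDiff hμ hσ hG1 hG2 c
  refine ge_of_tendsto (x := nhdsWithin (0 : ℝ) (Set.Ioi 0)) (f := fun ε =>
      ENNReal.ofReal (Real.exp (2 * |c| * ε + σ ^ 2 * Real.pi ^ 2 * c ^ 2 / 8))) ?_ ?_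
  · have : Continuous fun ε : ℝ =>
        ENNReal.ofReal (Real.exp (2 * |c| * ε + σ ^ 2 * Real.pi ^ 2 * c ^ 2 / 8)) :=
      ENNReal.continuous_ofReal.comp (by fun_prop)
    have := (this.tendsto 0).mono_left (nhdsWithin_le_nhds (s := Set.Ioi 0))
    simpa using this
  · filter_upwards [self_mem_nhdsWithin] with ε hε using key ε hε

/-- Concentration of a centered Gaussian measure around a set, in the form given by the
rotation argument of Maurey and Pisier. -/
theorem measure_mul_measure_le_infDist_le (hμ : μ[id] = 0) {σ : ℝ} (hσ0 : 0 < σ)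
    (hσ : ∀ L : StrongDual ℝ E, Var[L; μ] ≤ σ ^ 2 * ‖L‖ ^ 2) (A : Set E) {t : ℝ} (ht : 0 ≤ t) :
    μ {x | t ≤ Metric.infDist x A} * μ A ≤
      ENNReal.ofReal (Real.exp (-(2 * t ^ 2 / (Real.pi ^ 2 * σ ^ 2)))) := by
  have hpi := Real.pi_pos
  -- This c minimizes the Chernoff exponent σ²π²c²/8 - ct.
  set c : ℝ := 4 * t / (Real.pi ^ 2 * σ ^ 2) with hc
  have hc0 : 0 ≤ c := by positivity
  have h := lintegral_exp_sub_le_of_lipschitz hμ hσ (Metric.lipschitz_infDist_pt A) c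
  have hM := mul_meas_ge_le_lintegral₀ (μ := μ.prod μ)
    (f := fun z => ENNReal.ofReal (Real.exp (c * (Metric.infDist z.1 A - Metric.infDist z.2 A))))
    (by
      have := Metric.continuous_infDist_pt A
      have : Continuous fun z : E × E =>
        ENNReal.ofReal (Real.exp (c * (Metric.infDist z.1 A - Metric.infDist z.2 A))) :=
        ENNReal.continuous_ofReal.comp (by fun_prop)
      exact this.measurable.aemeasurable) (ENNReal.ofReal (Real.exp (c * t)))
  have hsub : {x | t ≤ Metric.infDist x A} ×ˢ A ⊆ {z : E × E | ENNReal.ofReal (Real.exp (c * t)) ≤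
      ENNReal.ofReal (Real.exp (c * (Metric.infDist z.1 A - Metric.infDist z.2 A)))} := by
    rintro ⟨x, y⟩ ⟨hx, hy⟩
    apply ENNReal.ofReal_le_ofReal
    rw [Real.exp_le_exp]
    refine mul_le_mul_of_nonneg_left ?_ hc0
    simp only [Metric.infDist_zero_of_mem hy, sub_zero]
    exact hx
  have h2 : ENNReal.ofReal (Real.exp (c * t)) * (μ {x | t ≤ Metric.infDist x A} * μ A) ≤
      ENNReal.ofReal (Real.exp (σ ^ 2 * Real.pi ^ 2 * c ^ 2 / 8)) := by
    rw [← Measure.prod_prod]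
    exact (mul_le_mul_right (measure_mono hsub) _).trans (hM.trans h)
  calc _ = ENNReal.ofReal (Real.exp (-(c * t))) * (ENNReal.ofReal (Real.exp (c * t)) *
        (μ {x | t ≤ Metric.infDist x A} * μ A)) := by
        rw [← mul_assoc, ← ENNReal.ofReal_mul (Real.exp_pos _).le, ← Real.exp_add]
        simp
    _ ≤ ENNReal.ofReal (Real.exp (-(c * t))) *
        ENNReal.ofReal (Real.exp (σ ^ 2 * Real.pi ^ 2 * c ^ 2 / 8)) := by gcongr
    _ = _ := by
        rw [← ENNReal.ofReal_mul (Real.exp_pos _).le, ← Real.exp_add, hc]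
        congr 2
        field_simp
        ring

end Concentration

/-! ### A set of probability at least 1/2 and its neighbourhoods -/

section GaussianEvent

/-- For a standard normal, the expectation is (1 - 2·3/8)^{-1/2} = 2, which explains 3/8; a smaller
variance only shrinks the integrand. -/
theorem lintegral_exp_sq_gaussianReal_le {v : NNReal} (hv : v ≤ 1) :
    ∫⁻ z, ENNReal.ofReal (Real.exp (3 / 8 * z ^ 2)) ∂(gaussianReal 0 v) ≤ 2 := by
  have hpi := Real.pi_pos
  have hmap : (gaussianReal 0 1).map (Real.sqrt v * ·) = gaussianReal 0 v := by
    rw [gaussianReal_map_const_mul]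
    congr 1
    · simp
    · ext; simp
  have hm : Measurable fun z : ℝ => ENNReal.ofReal (Real.exp (3 / 8 * z ^ 2)) := by fun_prop
  rw [← hmap, lintegral_map hm (by fun_prop)]
  have hv' : (v : ℝ) ≤ 1 := by exact_mod_cast hv
  calc ∫⁻ z, ENNReal.ofReal (Real.exp (3 / 8 * (Real.sqrt v * z) ^ 2)) ∂(gaussianReal 0 1)
      ≤ ∫⁻ z, ENNReal.ofReal (Real.exp (3 / 8 * z ^ 2)) ∂(gaussianReal 0 1) := by
        refine lintegral_mono fun z => ENNReal.ofReal_le_ofReal ?_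
        rw [Real.exp_le_exp, mul_pow, Real.sq_sqrt (NNReal.coe_nonneg v)]
        nlinarith [sq_nonneg z, mul_le_mul_of_nonneg_right hv' (sq_nonneg z)]
    _ = ∫⁻ z, ENNReal.ofReal ((Real.sqrt (2 * Real.pi))⁻¹ * Real.exp (-(1 / 8) * z ^ 2)) := by
        rw [gaussianReal_of_var_ne_zero _ one_ne_zero,
          lintegral_withDensity_eq_lintegral_mul _ (measurable_gaussianPDF _ _) hm]
        refine lintegral_congr fun z => ?_
        rw [Pi.mul_apply, gaussianPDF, ← ENNReal.ofReal_mul (gaussianPDFReal_nonneg _ _ _),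
          gaussianPDFReal, mul_assoc, ← Real.exp_add]
        congr 3
        · simp
        · simp; ring
    _ = ENNReal.ofReal (∫ z, (Real.sqrt (2 * Real.pi))⁻¹ * Real.exp (-(1 / 8) * z ^ 2)) := by
        rw [ofReal_integral_eq_lintegral_ofReal
          ((integrable_exp_neg_mul_sq (by norm_num)).const_mul _)
          (Filter.Eventually.of_forall fun _ => by positivity)]
    _ = 2 := by
        rw [integral_const_mul, integral_gaussian, ← Real.sqrt_inv, ← Real.sqrt_mul (by positivity)]
        rw [show (2 * Real.pi)⁻¹ * (Real.pi / (1 / 8)) = 2 ^ 2 by field_simp; norm_num,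
          Real.sqrt_sq (by norm_num)]
        simp
    _ ≤ 2 := le_rfl

variable {E : Type*} [NormedAddCommGroup E] [InnerProductSpace ℝ E] [FiniteDimensional ℝ E]
  [MeasurableSpace E] [BorelSpace E] {μ : Measure E} [IsGaussian μ]

theorem lintegral_exp_dual_sq_le (hμ : μ[id] = 0) {τ : ℝ} (hτ : 0 < τ) {L : StrongDual ℝ E}
    (hL : Var[L; μ] ≤ τ ^ 2) :
    ∫⁻ x, ENNReal.ofReal (Real.exp (3 / 8 * (L x / τ) ^ 2)) ∂μ ≤ 2 := by
  set M : StrongDual ℝ E := τ⁻¹ • L with hM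
  have h1 : μ[M] = 0 := by
    rw [IsGaussian.integral_dual]
    simp only [id_eq] at hμ
    simp [hμ]
  have hmap := IsGaussian.map_eq_gaussianReal (μ := μ) M
  rw [h1] at hmap
  have hvar : Var[M; μ] ≤ 1 := by
    have : (M : E → ℝ) = fun x => τ⁻¹ * L x := by ext; simp [hM]
    rw [this, variance_const_mul, inv_pow, inv_mul_le_iff₀ (by positivity)]
    simpa using hL
  have h := lintegral_exp_sq_gaussianReal_le (v := Var[M; μ].toNNReal)
    (by simpa using hvar)
  rw [← hmap, lintegral_map (by fun_prop) (by fun_prop)] at h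
  simpa [hM, div_eq_inv_mul] using h

/-- The vectors on which the linear forms `L j` are jointly of subgaussian size `τ`. -/
def subgaussianSet {ι : Type*} [Fintype ι] (L : ι → StrongDual ℝ E) (τ : ℝ) : Set E :=
  {x | ∑ j, Real.exp (3 / 8 * (L j x / τ) ^ 2) ≤ 2 * Real.exp 1 * Fintype.card ι}

omit [FiniteDimensional ℝ E] [MeasurableSpace E] [BorelSpace E] in
theorem isClosed_subgaussianSet {ι : Type*} [Fintype ι] (L : ι → StrongDual ℝ E) (τ : ℝ) :
    IsClosed (subgaussianSet L τ) :=
  isClosed_le (by fun_prop) continuous_const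

/-- Markov: the defining sum has mean at most 2·card, and the level is e times that, so failure has
probability at most 1/e ≤ 1/2. -/
theorem half_le_measure_subgaussianSet {ι : Type*} [Fintype ι] [Nonempty ι] (hμ : μ[id] = 0)
    {τ : ℝ} (hτ : 0 < τ) {L : ι → StrongDual ℝ E} (hL : ∀ j, Var[L j; μ] ≤ τ ^ 2) :
    2⁻¹ ≤ μ (subgaussianSet L τ) := by
  have he : (2 : ℝ) ≤ Real.exp 1 := by linarith [Real.add_one_le_exp 1]
  have hcard : (0 : ℝ) < Fintype.card ι := by exact_mod_cast Fintype.card_pos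
  have hmeas : MeasurableSet (subgaussianSet L τ) := (isClosed_subgaussianSet L τ).measurableSet
  set a : ℝ := 2 * Real.exp 1 * Fintype.card ι with ha
  have ha0 : 0 < a := by positivity
  have hint : ∫⁻ x, ENNReal.ofReal (∑ j, Real.exp (3 / 8 * (L j x / τ) ^ 2)) ∂μ ≤
      ENNReal.ofReal (2 * Fintype.card ι) := by
    simp_rw [ENNReal.ofReal_sum_of_nonneg fun j _ => (Real.exp_pos _).le]
    rw [lintegral_finsetSum _ (fun j _ => by fun_prop)]
    calc _ ≤ ∑ j : ι, (2 : ENNReal) :=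
          Finset.sum_le_sum fun j _ => lintegral_exp_dual_sq_le hμ hτ (hL j)
      _ = _ := by
        rw [ENNReal.ofReal_mul (by norm_num)]
        simp [mul_comm]
  have hM := mul_meas_ge_le_lintegral₀ (μ := μ)
    (f := fun x => ENNReal.ofReal (∑ j, Real.exp (3 / 8 * (L j x / τ) ^ 2)))
    (by fun_prop) (ENNReal.ofReal a)
  have hsub : (subgaussianSet L τ)ᶜ ⊆ {x | ENNReal.ofReal a ≤
      ENNReal.ofReal (∑ j, Real.exp (3 / 8 * (L j x / τ) ^ 2))} := by
    intro x hx
    rw [subgaussianSet, Set.mem_compl_iff, Set.mem_ofPred_eq, not_le] at hx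
    exact ENNReal.ofReal_le_ofReal hx.le
  have h1 : ENNReal.ofReal a * μ (subgaussianSet L τ)ᶜ ≤ ENNReal.ofReal (2 * Fintype.card ι) :=
    (mul_le_mul_right (measure_mono hsub) _).trans (hM.trans hint)
  have h2 : μ.real (subgaussianSet L τ)ᶜ ≤ 1 / 2 := by
    have := ENNReal.toReal_mono ENNReal.ofReal_ne_top h1
    rw [ENNReal.toReal_mul, ENNReal.toReal_ofReal ha0.le, ENNReal.toReal_ofReal (by positivity)]
      at this
    change a * μ.real (subgaussianSet L τ)ᶜ ≤ _ at this
    have hnn : 0 ≤ μ.real (subgaussianSet L τ)ᶜ := measureReal_nonneg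
    have : 2 * Fintype.card ι * (Real.exp 1 * μ.real (subgaussianSet L τ)ᶜ) ≤
        2 * Fintype.card ι * 1 := by rw [ha] at this; linarith
    have := le_of_mul_le_mul_left this (by positivity)
    nlinarith
  rw [probReal_compl_eq_one_sub hmeas] at h2
  have h3 : (1 / 2 : ℝ) ≤ μ.real (subgaussianSet L τ) := by linarith
  rw [← ENNReal.ofReal_toReal (measure_ne_top μ (subgaussianSet L τ))]
  rw [show (2⁻¹ : ENNReal) = ENNReal.ofReal (1 / 2) by
    rw [ENNReal.ofReal_div_of_pos (by norm_num)]; simp]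
  exact ENNReal.ofReal_le_ofReal h3

/-- At this distance the concentration bound is e^{-2l}. Dividing by the measure 1/2 gives 2e^{-2l},
and l ≥ log(2e) makes e^{-l} ≤ 1/4, which leaves e^{-l}/2. -/
theorem measureReal_infDist_subgaussianSet_le {ι : Type*} [Fintype ι] [Nonempty ι]
    (hμ : μ[id] = 0) {σ : ℝ} (hσ0 : 0 < σ)
    (hσ : ∀ L : StrongDual ℝ E, Var[L; μ] ≤ σ ^ 2 * ‖L‖ ^ 2) {τ : ℝ} (hτ : 0 < τ)
    {L : ι → StrongDual ℝ E} (hL : ∀ j, Var[L j; μ] ≤ τ ^ 2) {l : ℝ}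
    (hl : Real.log (2 * Real.exp 1) ≤ l) :
    1 - 1 / 2 * Real.exp (-l) ≤
      μ.real {x | Metric.infDist x (subgaussianSet L τ) ≤ Real.pi * σ * Real.sqrt l} := by
  have hpi := Real.pi_pos
  have he : (2 : ℝ) ≤ Real.exp 1 := by linarith [Real.add_one_le_exp 1]
  have hl0 : 0 ≤ l := (Real.log_nonneg (by linarith)).trans hl
  set t := Real.pi * σ * Real.sqrt l with ht
  have hcl : MeasurableSet {x | Metric.infDist x (subgaussianSet L τ) ≤ t} :=
    (isClosed_le (Metric.continuous_infDist_pt _) continuous_const).measurableSet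
  have h := measure_mul_measure_le_infDist_le hμ hσ0 hσ (subgaussianSet L τ)
    (t := t) (by positivity)
  have h1 : μ {x | t ≤ Metric.infDist x (subgaussianSet L τ)} * 2⁻¹ ≤
      ENNReal.ofReal (Real.exp (-(2 * t ^ 2 / (Real.pi ^ 2 * σ ^ 2)))) :=
    (mul_le_mul_right (half_le_measure_subgaussianSet hμ hτ hL) _).trans h
  have h2 := ENNReal.toReal_mono ENNReal.ofReal_ne_top h1
  rw [ENNReal.toReal_mul, ENNReal.toReal_ofReal (Real.exp_pos _).le] at h2
  change μ.real _ * _ ≤ _ at h2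
  have e1 : 2 * t ^ 2 / (Real.pi ^ 2 * σ ^ 2) = l + l := by
    rw [ht, mul_pow, mul_pow, Real.sq_sqrt hl0]
    field_simp; ring
  rw [e1, neg_add, Real.exp_add] at h2
  have h3 : Real.exp (-l) ≤ 1 / 4 := by
    rw [Real.exp_neg, inv_le_comm₀ (Real.exp_pos _) (by norm_num)]
    have := Real.exp_le_exp.2 hl
    rw [Real.exp_log (by positivity)] at this
    linarith
  have h4 : μ.real {x | Metric.infDist x (subgaussianSet L τ) ≤ t}ᶜ ≤
      μ.real {x | t ≤ Metric.infDist x (subgaussianSet L τ)} :=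
    measureReal_mono fun x hx => by
      rw [Set.mem_compl_iff, Set.mem_ofPred_eq, not_le] at hx
      exact hx.le
  rw [probReal_compl_eq_one_sub hcl] at h4
  have h5 : (2⁻¹ : ENNReal).toReal = 1 / 2 := by simp
  rw [h5] at h2
  nlinarith [Real.exp_pos (-l)]

end GaussianEvent

/-! ### Variance of linear forms under isotropic Gaussian noise -/

section Multivariate

variable {n : ℕ} {σ : ℝ}

theorem variance_multivariateGaussian_smul_one (L : StrongDual ℝ (EuclideanSpace ℝ (Fin n))) :
    Var[L; multivariateGaussian 0 (σ ^ 2 • (1 : Matrix (Fin n) (Fin n) ℝ))] =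
      σ ^ 2 * ‖L‖ ^ 2 := by
  have hS : (σ ^ 2 • (1 : Matrix (Fin n) (Fin n) ℝ)).PosSemidef :=
    Matrix.PosSemidef.one.smul (sq_nonneg σ)
  obtain ⟨a, rfl⟩ := (InnerProductSpace.toDual ℝ (EuclideanSpace ℝ (Fin n))).surjective L
  have h := covarianceBilin_self (x := a) (IsGaussian.memLp_two_id
    (μ := multivariateGaussian 0 (σ ^ 2 • (1 : Matrix (Fin n) (Fin n) ℝ))))
  rw [covarianceBilin_multivariateGaussian hS] at h
  rw [LinearIsometryEquiv.norm_map, EuclideanSpace.real_norm_sq_eq]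
  change Var[fun x => inner ℝ a x; _] = _
  rw [← h, Matrix.smul_mulVec, Matrix.one_mulVec, dotProduct_smul, smul_eq_mul]
  simp [dotProduct, sq]

end Multivariate

/-! ### Largest entries and rearrangement -/

section Rearrangement

variable {ι : Type*} [Fintype ι]

theorem exists_card_eq_threshold [DecidableEq ι] {h : ι → ℝ} (hh : ∀ i, 0 ≤ h i) {s : ℕ}
    (hs : s ≤ Fintype.card ι) :
    ∃ (W : Finset ι) (τ : ℝ), W.card = s ∧ 0 ≤ τ ∧ (∀ i ∈ W, τ ≤ h i) ∧ ∀ i ∉ W, h i ≤ τ := by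
  induction s with
  | zero =>
    -- With W empty the threshold must dominate every value; the total does.
    exact ⟨∅, ∑ i, h i, rfl, Finset.sum_nonneg fun i _ => hh i, by simp,
      fun i _ => Finset.single_le_sum (fun j _ => hh j) (Finset.mem_univ i)⟩
  | succ s ih =>
    obtain ⟨W, τ, hc, h0, h1, h2⟩ := ih (by omega)
    have hne : (Wᶜ).Nonempty := by
      rw [← Finset.card_pos, Finset.card_compl]; omega
    obtain ⟨j, hj, hmax⟩ := Finset.exists_max_image Wᶜ h hne
    rw [Finset.mem_compl] at hj
    refine ⟨insert j W, h j, by rw [Finset.card_insert_of_notMem hj, hc], hh j, ?_, ?_⟩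
    · intro i hi
      rcases Finset.mem_insert.1 hi with rfl | hi
      · exact le_rfl
      · exact (h2 j hj).trans (h1 i hi)
    · intro i hi
      rw [Finset.mem_insert, not_or] at hi
      exact hmax i (Finset.mem_compl.2 hi.2)

omit [Fintype ι] in
-- After subtracting τ, terms are nonnegative on T and nonpositive off T; the correction τ·card has
-- the right sign since τ ≥ 0.
theorem sum_le_sum_of_threshold [DecidableEq ι] {h : ι → ℝ} {S T : Finset ι} {τ : ℝ}
    (h0 : 0 ≤ τ) (h1 : ∀ i ∈ T, τ ≤ h i) (h2 : ∀ i ∉ T, h i ≤ τ) (hST : S.card ≤ T.card) :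
    ∑ i ∈ S, h i ≤ ∑ i ∈ T, h i := by
  have key : ∑ i ∈ S, (h i - τ) ≤ ∑ i ∈ T, (h i - τ) := by
    rw [← Finset.sum_inter_add_sum_sdiff S T, ← Finset.sum_inter_add_sum_sdiff T S,
      Finset.inter_comm T S]
    have e1 : ∑ i ∈ S \ T, (h i - τ) ≤ 0 := Finset.sum_nonpos fun i hi =>
      sub_nonpos.2 (h2 i (Finset.mem_sdiff.1 hi).2)
    have e2 : 0 ≤ ∑ i ∈ T \ S, (h i - τ) := Finset.sum_nonneg fun i hi =>
      sub_nonneg.2 (h1 i (Finset.mem_sdiff.1 hi).1)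
    linarith
  simp only [Finset.sum_sub_distrib, Finset.sum_const, nsmul_eq_mul] at key
  have : (S.card : ℝ) ≤ T.card := by exact_mod_cast hST
  nlinarith

theorem sum_mul_le_of_sum_sq_le {a b : ι → ℝ} (ha : ∀ i, 0 ≤ a i)
    (hb : ∀ i, 0 ≤ b i) {s : ℕ} (hs : 1 ≤ s) (hsc : s ≤ Fintype.card ι) {R : ℝ} (hR : 0 ≤ R)
    (haR : ∀ W : Finset ι, W.card = s → ∑ i ∈ W, a i ^ 2 ≤ R ^ 2) [DecidableEq ι]
    {T : Finset ι} (hT : T.card = s) :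
    ∑ i, a i * b i ≤ R * (Real.sqrt (∑ i, b i ^ 2) + (∑ i ∈ Tᶜ, b i) / Real.sqrt s) := by
  obtain ⟨W, τ, hc, h0, h1, h2⟩ := exists_card_eq_threshold ha hsc
  have hs0 : (0 : ℝ) < s := by exact_mod_cast hs
  have hτ : τ ≤ R / Real.sqrt s := by
    rw [le_div_iff₀ (Real.sqrt_pos.2 hs0)]
    refine le_of_sq_le_sq ?_ hR
    rw [mul_pow, Real.sq_sqrt hs0.le]
    calc τ ^ 2 * s = ∑ i ∈ W, τ ^ 2 := by rw [Finset.sum_const, hc, nsmul_eq_mul, mul_comm]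
      _ ≤ ∑ i ∈ W, a i ^ 2 := Finset.sum_le_sum fun i hi => by
          have := h1 i hi
          gcongr
      _ ≤ R ^ 2 := haR W hc
  -- The part of a above the threshold stays on W, while the level τ is moved from W to T. Then a ≤
  -- c + τ·1_{Tᶜ}, and as |W| = |T| the sum of c² stays below that of a² over W, because (a - τ)² ≤
  -- a² - τ² for a ≥ τ.
  set c : ι → ℝ := fun i => (if i ∈ T then τ else 0) + (if i ∈ W then a i - τ else 0) with hcdef
  have hcsq : ∑ i, c i ^ 2 ≤ R ^ 2 := by
    calc ∑ i, c i ^ 2 ≤ ∑ i, ((if i ∈ W then a i ^ 2 else 0) + (if i ∈ T then τ ^ 2 else 0)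
          - (if i ∈ W then τ ^ 2 else 0)) := by
          refine Finset.sum_le_sum fun i _ => ?_
          simp only [hcdef]
          by_cases hiW : i ∈ W <;> by_cases hiT : i ∈ T <;> simp only [hiW, hiT, if_true, if_false]
          · nlinarith
          · nlinarith [h1 i hiW]
          · nlinarith
          · nlinarith
      _ = ∑ i ∈ W, a i ^ 2 := by
          rw [Finset.sum_sub_distrib, Finset.sum_add_distrib]
          simp [hc, hT]
      _ ≤ R ^ 2 := haR W hc
  have hCS : ∑ i, c i * b i ≤ R * Real.sqrt (∑ i, b i ^ 2) := by
    refine (Real.sum_mul_le_sqrt_mul_sqrt _ _ _).trans ?_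
    gcongr
    exact Real.sqrt_le_iff.2 ⟨hR, hcsq⟩
  have hpt : ∑ i, a i * b i ≤ ∑ i, (c i * b i + τ * (if i ∈ Tᶜ then b i else 0)) := by
    refine Finset.sum_le_sum fun i _ => ?_
    simp only [hcdef, Finset.mem_compl]
    by_cases hiW : i ∈ W <;> by_cases hiT : i ∈ T <;> simp only [hiW, hiT, if_true, if_false,
      not_true, not_false_eq_true]
    · nlinarith
    · nlinarith
    · nlinarith [mul_le_mul_of_nonneg_right (h2 i hiW) (hb i)]
    · nlinarith [mul_le_mul_of_nonneg_right (h2 i hiW) (hb i)]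
  rw [Finset.sum_add_distrib, ← Finset.mul_sum, Finset.sum_ite_mem, Finset.univ_inter] at hpt
  have hB : 0 ≤ ∑ i ∈ Tᶜ, b i := Finset.sum_nonneg fun i _ => hb i
  calc _ ≤ R * Real.sqrt (∑ i, b i ^ 2) + R / Real.sqrt s * ∑ i ∈ Tᶜ, b i := by
        have := mul_le_mul_of_nonneg_right hτ hB
        linarith
    _ = _ := by ring

/-- Jensen for the mean over W. The division by s is what produces log(2ep/s) instead of log p. -/
theorem sum_sq_le_of_sum_exp_le {a : ι → ℝ} {W : Finset ι} {s : ℕ} (hs : 1 ≤ s) (hW : W.card = s)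
    {K : ℝ} (hK : ∑ i, Real.exp (a i) ≤ K) : ∑ i ∈ W, a i ≤ s * Real.log (K / s) := by
  have hs0 : (0 : ℝ) < s := by exact_mod_cast hs
  have hJ := convexOn_exp.map_sum_le (t := W) (w := fun _ => (s : ℝ)⁻¹) (p := a)
    (fun _ _ => by positivity) (by simp [hW, hs0.ne']) (by simp)
  simp only [smul_eq_mul, ← Finset.mul_sum] at hJ
  have h1 : ∑ i ∈ W, Real.exp (a i) ≤ K :=
    (Finset.sum_le_univ_sum_of_nonneg fun i => (Real.exp_pos _).le).trans hK
  have h2 : Real.exp ((s : ℝ)⁻¹ * ∑ i ∈ W, a i) ≤ K / s := by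
    rw [div_eq_inv_mul]
    exact hJ.trans (by gcongr)
  have h3 := (Real.le_log_iff_exp_le ((Real.exp_pos _).trans_le h2)).2 h2
  rwa [inv_mul_le_iff₀ hs0] at h3

end Rearrangement

/-! ### Norms and interpolation -/

section Norms

theorem lqNorm_one {p : ℕ} (β : Fin p → ℝ) : lqNorm 1 β = ∑ j, |β j| := by
  simp [lqNorm]

theorem lqNorm_two {p : ℕ} (β : Fin p → ℝ) : lqNorm 2 β = Real.sqrt (∑ j, β j ^ 2) := by
  simp [lqNorm, Real.sqrt_eq_rpow]

theorem empNorm_sq {n : ℕ} (u : Fin n → ℝ) : empNorm u ^ 2 = (1 / (n : ℝ)) * ∑ i, u i ^ 2 :=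
  Real.sq_sqrt (by positivity)

/-- With x = |u_j|/C, weighted AM-GM gives x^q = x^{2-q}(x²)^{q-1} ≤ (2-q)x + (q-1)x²; then sum over
j. -/
theorem lqNorm_le_of_sum_le {p : ℕ} {u : Fin p → ℝ} {C S q : ℝ} (hC : 0 < C) (hS : 0 ≤ S)
    (hq1 : 1 ≤ q) (hq2 : q ≤ 2) (h1 : ∑ j, |u j| ≤ C * S) (h2 : ∑ j, u j ^ 2 ≤ C ^ 2 * S) :
    lqNorm q u ≤ C * S ^ (1 / q) := by
  have hpt : ∀ j, |u j| ^ q ≤ C ^ q * ((2 - q) * (|u j| / C) + (q - 1) * (u j ^ 2 / C ^ 2)) := by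
    intro j
    have hx : 0 ≤ |u j| / C := by positivity
    have h := Real.geom_mean_le_arith_mean2_weighted (w₁ := 2 - q) (w₂ := q - 1)
      (p₁ := |u j| / C) (p₂ := (|u j| / C) ^ 2) (by linarith) (by linarith) hx (by positivity)
      (by ring)
    rw [← Real.rpow_natCast (|u j| / C) 2, ← Real.rpow_mul hx, ← Real.rpow_add' hx
      (by push_cast; linarith)] at h
    rw [show 2 - q + ((2 : ℕ) : ℝ) * (q - 1) = q by push_cast; ring, Real.rpow_natCast,
      Real.div_rpow (abs_nonneg _) hC.le, div_le_iff₀ (by positivity), div_pow, sq_abs] at h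
    linarith
  have hsum : ∑ j, |u j| ^ q ≤ C ^ q * S := by
    refine (Finset.sum_le_sum fun j _ => hpt j).trans ?_
    rw [← Finset.mul_sum, Finset.sum_add_distrib, ← Finset.mul_sum, ← Finset.mul_sum,
      ← Finset.sum_div, ← Finset.sum_div]
    have e1 : (∑ j, |u j|) / C ≤ S := by rw [div_le_iff₀ hC]; linarith
    have e2 : (∑ j, u j ^ 2) / C ^ 2 ≤ S := by rw [div_le_iff₀ (by positivity)]; linarith
    refine mul_le_mul_of_nonneg_left ?_ (by positivity)
    nlinarith
  calc lqNorm q u ≤ (C ^ q * S) ^ (1 / q) :=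
        Real.rpow_le_rpow (Finset.sum_nonneg fun j _ => by positivity) hsum (by positivity)
    _ = _ := by
        rw [Real.mul_rpow (by positivity) hS, ← Real.rpow_mul hC.le,
          mul_one_div_cancel (by linarith), Real.rpow_one]

end Norms

/-! ### Deterministic inequalities for the Lasso -/

section Deterministic

variable {n p : ℕ}

theorem sreTheta_mul_le {X : Matrix (Fin n) (Fin p) ℝ} {s : ℕ} {c : ℝ} {δ : Fin p → ℝ}
    (hδ : lqNorm 1 δ ≤ (1 + c) * Real.sqrt s * lqNorm 2 δ) :
    sreTheta X s c * lqNorm 2 δ ≤ empNorm (X *ᵥ δ) := by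
  have hnn : ∀ δ : Fin p → ℝ, 0 ≤ lqNorm 2 δ := fun δ => by rw [lqNorm_two]; positivity
  have hen : ∀ u : Fin n → ℝ, 0 ≤ empNorm u := fun u => Real.sqrt_nonneg _
  rcases eq_or_ne δ 0 with rfl | h0
  · simpa [lqNorm_two] using hen _
  · have hpos : 0 < lqNorm 2 δ := by
      rw [lqNorm_two, Real.sqrt_pos]
      obtain ⟨j, hj⟩ := Function.ne_iff.1 h0
      exact Finset.sum_pos' (fun i _ => sq_nonneg _) ⟨j, Finset.mem_univ j, sq_pos_of_ne_zero hj⟩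
    rw [← le_div_iff₀ hpos]
    refine csInf_le ⟨0, ?_⟩ ⟨δ, ⟨hδ, h0⟩, rfl⟩
    rintro _ ⟨δ', -, rfl⟩
    exact div_nonneg (hen _) (hnn _)

/-- Basis vectors lie in the cone. With normalized columns this yields θ ≤ 1, and it rules out n = 0
when θ > 0. -/
theorem sreTheta_le_empNorm_single (X : Matrix (Fin n) (Fin p) ℝ) {s : ℕ} (hs : 1 ≤ s) {c : ℝ}
    (hc : 0 ≤ c) (j : Fin p) : sreTheta X s c ≤ empNorm (X *ᵥ Pi.single j 1) := by
  have e1 : lqNorm 1 (Pi.single j (1 : ℝ)) = 1 := by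
    rw [lqNorm_one, Finset.sum_eq_single j] <;> simp +contextual
  have e2 : lqNorm 2 (Pi.single j (1 : ℝ)) = 1 := by
    rw [lqNorm_two, Finset.sum_eq_single j] <;> simp +contextual
  have hs1 : 1 ≤ Real.sqrt s := Real.one_le_sqrt.2 (by exact_mod_cast hs)
  have h := sreTheta_mul_le (X := X) (s := s) (c := c) (δ := Pi.single j (1 : ℝ))
    (by rw [e1, e2]; nlinarith)
  rwa [e2, mul_one] at h

/-- The first order optimality condition of the Lasso. -/
theorem IsLasso.basic_inequality {X : Matrix (Fin n) (Fin p) ℝ} {lam : ℝ} (hlam : 0 ≤ lam)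
    {f ξ : Fin n → ℝ} {βh : Fin p → ℝ} (h : IsLasso X lam (fun i => f i + ξ i) βh)
    (β : Fin p → ℝ) :
    empNorm (X *ᵥ βh - f) ^ 2 ≤ empNorm (X *ᵥ β - f) ^ 2 - empNorm (X *ᵥ (βh - β)) ^ 2 +
      2 * (1 / n * ∑ i, ξ i * (X *ᵥ (βh - β)) i) + 2 * lam * (lqNorm 1 β - lqNorm 1 βh) := by
  set a : Fin n → ℝ := X *ᵥ βh - f with ha
  set d : Fin n → ℝ := X *ᵥ (βh - β) with hd
  have hexp : ∀ x y : Fin n → ℝ, ∀ c : ℝ, empNorm (fun i => x i - c * y i) ^ 2 =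
      empNorm x ^ 2 - 2 * c * (1 / n * ∑ i, x i * y i) + c ^ 2 * empNorm y ^ 2 := by
    intro x y c
    simp only [empNorm_sq]
    have : ∑ i, (x i - c * y i) ^ 2 = ∑ i, x i ^ 2 - 2 * c * ∑ i, x i * y i
        + c ^ 2 * ∑ i, y i ^ 2 := by
      rw [Finset.mul_sum, Finset.mul_sum, ← Finset.sum_sub_distrib, ← Finset.sum_add_distrib]
      exact Finset.sum_congr rfl fun i _ => by ring
    rw [this]; ring
  have hβ : X *ᵥ β - f = fun i => a i - 1 * d i := by
    ext i
    simp [ha, hd, Matrix.mulVec_sub]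
  set I : ℝ := 1 / n * ∑ i, (a i - ξ i) * d i with hI
  -- Compare βh with points of the segment towards β and let ε tend to 0. Taking ε = 1 only would
  -- lose the term -‖X(βh - β)‖_n².
  have hdir : ∀ ε : ℝ, 0 < ε → ε ≤ 1 →
      2 * I ≤ ε * empNorm d ^ 2 + 2 * lam * (lqNorm 1 β - lqNorm 1 βh) := by
    intro ε h0 h1
    have hm := h (fun j => βh j - ε * (βh j - β j))
    have e1 : X *ᵥ βh - (fun i => f i + ξ i) = fun i => a i - ξ i := by
      ext i; simp [ha]; ring
    have e2 : X *ᵥ (fun j => βh j - ε * (βh j - β j)) - (fun i => f i + ξ i) =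
        fun i => (a i - ξ i) - ε * d i := by
      have : (fun j => βh j - ε * (βh j - β j)) = βh - ε • (βh - β) := by
        ext j; simp
      rw [this, Matrix.mulVec_sub, Matrix.mulVec_smul]
      ext i; simp [ha, hd]; ring
    have e3 : lqNorm 1 (fun j => βh j - ε * (βh j - β j)) ≤
        (1 - ε) * lqNorm 1 βh + ε * lqNorm 1 β := by
      simp only [lqNorm_one]
      rw [Finset.mul_sum, Finset.mul_sum, ← Finset.sum_add_distrib]
      refine Finset.sum_le_sum fun j _ => ?_
      calc |βh j - ε * (βh j - β j)| = |(1 - ε) * βh j + ε * β j| := by ring_nf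
        _ ≤ |(1 - ε) * βh j| + |ε * β j| := abs_add_le _ _
        _ = _ := by rw [abs_mul, abs_mul, abs_of_nonneg (sub_nonneg.2 h1), abs_of_pos h0]
    rw [e1, e2, hexp (fun i => a i - ξ i) d ε] at hm
    have e4 := mul_le_mul_of_nonneg_left e3 (show 0 ≤ 2 * lam by linarith)
    have : ε * (2 * I) ≤ ε * (ε * empNorm d ^ 2 + 2 * lam * (lqNorm 1 β - lqNorm 1 βh)) := by
      rw [hI]
      linarith
    exact le_of_mul_le_mul_left this h0
  have hlim : 2 * I ≤ 2 * lam * (lqNorm 1 β - lqNorm 1 βh) := by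
    refine ge_of_tendsto (x := nhdsWithin (0 : ℝ) (Set.Ioi 0))
      (f := fun ε => ε * empNorm d ^ 2 + 2 * lam * (lqNorm 1 β - lqNorm 1 βh)) ?_ ?_
    · have : Continuous fun ε : ℝ =>
        ε * empNorm d ^ 2 + 2 * lam * (lqNorm 1 β - lqNorm 1 βh) := by fun_prop
      have := (this.tendsto 0).mono_left (nhdsWithin_le_nhds (s := Set.Ioi 0))
      simpa using this
    · filter_upwards [Ioc_mem_nhdsGT (zero_lt_one' ℝ)] with ε hε using hdir ε hε.1 hε.2
  rw [hβ, hexp a d 1]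
  have hIe : I = 1 / n * ∑ i, a i * d i - 1 / n * ∑ i, ξ i * d i := by
    rw [hI, ← mul_sub, ← Finset.sum_sub_distrib]
    exact congrArg _ (Finset.sum_congr rfl fun i _ => by ring)
  linarith

/-- On the support S of β the triangle inequality applies; off S the difference is exactly -|u_i|.
Exchanging S for T can only increase 2∑_S|u| - |u|_1. -/
theorem lqNorm_one_sub_le {β βh : Fin p → ℝ} {T : Finset (Fin p)} {τ : ℝ} (h0 : 0 ≤ τ)
    (h1 : ∀ i ∈ T, τ ≤ |(βh - β) i|) (h2 : ∀ i ∉ T, |(βh - β) i| ≤ τ)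
    (hβ : hammingNorm β ≤ T.card) :
    lqNorm 1 β - lqNorm 1 βh ≤ ∑ i ∈ T, |(βh - β) i| - ∑ i ∈ Tᶜ, |(βh - β) i| := by
  set S := Finset.univ.filter fun i => β i ≠ 0 with hS
  have hST := sum_le_sum_of_threshold (S := S) (h := fun i => |(βh - β) i|) h0 h1 h2 hβ
  have hT := Finset.sum_add_sum_compl T fun i => |(βh - β) i|
  have hS' := Finset.sum_add_sum_compl S fun i => |(βh - β) i|
  have : lqNorm 1 β - lqNorm 1 βh ≤ ∑ i ∈ S, |(βh - β) i| - ∑ i ∈ Sᶜ, |(βh - β) i| := by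
    rw [lqNorm_one, lqNorm_one, ← Finset.sum_sub_distrib, ← Finset.sum_add_sum_compl S,
      sub_eq_add_neg (∑ i ∈ S, |(βh - β) i|), ← Finset.sum_neg_distrib]
    refine add_le_add (Finset.sum_le_sum fun i _ => ?_) (Finset.sum_le_sum fun i hi => ?_)
    · rw [Pi.sub_apply, abs_sub_comm]
      exact abs_sub_abs_le_abs_sub _ _
    · have : β i = 0 := by simpa [hS] using hi
      simp [this]
  linarith

/-- If the maximum is (r/θ)Z, then A ≤ M ≤ (r/θ)Z suffices. Otherwise Δ ≤ λ(7M - B)/2: either B ≤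
7M, which puts u in the cone, or B > 7M and Δ ≤ 0. This is where c₀ = 7 originates. -/
theorem lasso_remainder_le {A B M Z r θ lam : ℝ} (hAM : A ≤ M) (hB : 0 ≤ B) (hlam : 0 ≤ lam)
     (hθ : 0 < θ) (hcone : A + B ≤ 8 * M → θ * M ≤ r * Z) :
    let Δ := lam / 2 * (A + B) + 2 * lam * (A - B) + lam * max (M + B) (r / θ * Z)
    (M ≤ r / θ * Z ∧ Δ ≤ 7 / 2 * lam * (r / θ * Z)) ∨ Δ ≤ 0 := by
  intro Δ
  have hcone' : A + B ≤ 8 * M → M ≤ r / θ * Z := fun h => by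
    rw [div_mul_eq_mul_div, le_div_iff₀ hθ, mul_comm]; exact hcone h
  have h1 := mul_le_mul_of_nonneg_left hAM hlam
  have h2 := mul_nonneg hlam hB
  rcases le_total (M + B) (r / θ * Z) with h | h
  · left
    refine ⟨by linarith, ?_⟩
    have h3 := mul_le_mul_of_nonneg_left h hlam
    simp only [Δ, max_eq_right h]
    nlinarith
  · simp only [Δ, max_eq_left h]
    by_cases hB7 : B ≤ 7 * M
    · left
      have hM := hcone' (by linarith)
      refine ⟨hM, ?_⟩
      have h3 := mul_le_mul_of_nonneg_left hM hlam
      nlinarith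
    · right
      have h3 := mul_le_mul_of_nonneg_left (not_le.1 hB7).le hlam
      nlinarith

end Deterministic

/-! ### Uniform control of the noise -/

section Noise

variable {n p : ℕ}

/-- The linear form `v ↦ ∑ i, X i j * v i` given by the `j`-th column of `X`. -/
noncomputable def columnForm (X : Matrix (Fin n) (Fin p) ℝ) (j : Fin p) :
    StrongDual ℝ (EuclideanSpace ℝ (Fin n)) :=
  innerSL ℝ (WithLp.toLp 2 fun i => X i j)

theorem columnForm_apply (X : Matrix (Fin n) (Fin p) ℝ) (j : Fin p)
    (v : EuclideanSpace ℝ (Fin n)) : columnForm X j v = ∑ i, X i j * v i := by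
  simp [columnForm, PiLp.inner_apply, mul_comm]

theorem norm_columnForm_sq_le (X : Matrix (Fin n) (Fin p) ℝ) (hn : 0 < n) {j : Fin p}
    (hj : empNorm (X *ᵥ Pi.single j 1) ≤ 1) : ‖columnForm X j‖ ^ 2 ≤ n := by
  have hn' : (0 : ℝ) < n := by exact_mod_cast hn
  have h : empNorm (X *ᵥ Pi.single j 1) ^ 2 ≤ 1 := pow_le_one₀ (Real.sqrt_nonneg _) hj
  rw [empNorm_sq, one_div, inv_mul_le_iff₀ hn', mul_one] at h
  rw [columnForm, innerSL_apply_norm, EuclideanSpace.real_norm_sq_eq]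
  simpa using h

theorem sum_columnForm_mul (X : Matrix (Fin n) (Fin p) ℝ) (v : EuclideanSpace ℝ (Fin n))
    (u : Fin p → ℝ) : ∑ i, v i * (X *ᵥ u) i = ∑ j, columnForm X j v * u j := by
  simp only [columnForm_apply, Matrix.mulVec, dotProduct, Finset.mul_sum, Finset.sum_mul]
  rw [Finset.sum_comm]
  exact Finset.sum_congr rfl fun j _ => Finset.sum_congr rfl fun i _ => by ring

/-- The part of the noise in `subgaussianSet`, tested against `X u`. -/
theorem sum_mul_mulVec_le_of_mem_subgaussianSet {X : Matrix (Fin n) (Fin p) ℝ} {s : ℕ}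
    (hs : 1 ≤ s) (hsp : s ≤ p) {τ : ℝ} (hτ : 0 < τ) {v : EuclideanSpace ℝ (Fin n)}
    (hv : v ∈ subgaussianSet (columnForm X) τ) (u : Fin p → ℝ) {T : Finset (Fin p)}
    (hT : T.card = s) :
    ∑ i, v i * (X *ᵥ u) i ≤
      Real.sqrt (8 / 3) * τ * Real.sqrt (Real.log (2 * Real.exp 1 * p / s)) *
        (Real.sqrt s * Real.sqrt (∑ j, u j ^ 2) + ∑ j ∈ Tᶜ, |u j|) := by
  have hs0 : (0 : ℝ) < s := by exact_mod_cast hs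
  have hv' : ∑ j, Real.exp (3 / 8 * (columnForm X j v / τ) ^ 2) ≤ 2 * Real.exp 1 * p := by
    simpa [subgaussianSet] using hv
  set Λ := Real.log (2 * Real.exp 1 * p / s) with hΛ
  have hW : ∀ W : Finset (Fin p), W.card = s →
      ∑ j ∈ W, |columnForm X j v| ^ 2 ≤ 8 / 3 * τ ^ 2 * (s * Λ) := by
    intro W hW
    have h := sum_sq_le_of_sum_exp_le hs hW hv'
    calc ∑ j ∈ W, |columnForm X j v| ^ 2
        = 8 / 3 * τ ^ 2 * ∑ j ∈ W, 3 / 8 * (columnForm X j v / τ) ^ 2 := by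
          rw [Finset.mul_sum]
          refine Finset.sum_congr rfl fun j _ => ?_
          rw [sq_abs]; field_simp
      _ ≤ _ := by gcongr
  have hΛ0 : 0 ≤ Λ := by
    obtain ⟨W, -, hWc⟩ := Finset.exists_subset_card_eq (s := (Finset.univ : Finset (Fin p)))
      (n := s) (by simpa using hsp)
    have h1 := (Finset.sum_nonneg fun j _ => sq_nonneg _).trans (hW W hWc)
    by_contra hneg
    have : 8 / 3 * τ ^ 2 * (s * Λ) < 0 :=
      mul_neg_of_pos_of_neg (by positivity) (mul_neg_of_pos_of_neg hs0 (not_le.1 hneg))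
    linarith
  set R := Real.sqrt (8 / 3) * τ * Real.sqrt Λ * Real.sqrt s with hR
  have hR2 : R ^ 2 = 8 / 3 * τ ^ 2 * (s * Λ) := by
    rw [hR, mul_pow, mul_pow, mul_pow, Real.sq_sqrt (by norm_num), Real.sq_sqrt hΛ0,
      Real.sq_sqrt hs0.le]
    ring
  have h := sum_mul_le_of_sum_sq_le (a := fun j => |columnForm X j v|) (b := fun j => |u j|)
    (fun _ => abs_nonneg _) (fun _ => abs_nonneg _) hs (by simpa using hsp)
    (R := R) (by positivity) (by rw [hR2]; exact hW) hT
  have hss : Real.sqrt s ≠ 0 := (Real.sqrt_pos.2 hs0).ne'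
  calc ∑ i, v i * (X *ᵥ u) i = ∑ j, columnForm X j v * u j := sum_columnForm_mul X v u
    _ ≤ ∑ j, |columnForm X j v| * |u j| := Finset.sum_le_sum fun j _ => by
        rw [← abs_mul]; exact le_abs_self _
    _ ≤ _ := h
    _ = _ := by
        simp only [sq_abs]
        rw [hR]
        field_simp

theorem sum_mul_le_norm_mul_empNorm (hn : 0 < n) (w : EuclideanSpace ℝ (Fin n))
    (z : Fin n → ℝ) : ∑ i, w i * z i ≤ Real.sqrt n * (‖w‖ * empNorm z) := by
  have hn' : (0 : ℝ) < n := by exact_mod_cast hn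
  refine (Real.sum_mul_le_sqrt_mul_sqrt _ _ _).trans_eq ?_
  have : Real.sqrt (∑ i, z i ^ 2) = Real.sqrt n * empNorm z := by
    rw [empNorm, ← Real.sqrt_mul hn'.le]
    congr 1
    field_simp
  rw [this, EuclideanSpace.norm_eq]
  simp only [Real.norm_eq_abs, sq_abs]
  ring

theorem sqrt_eight_thirds_add_pi_le : Real.sqrt (8 / 3) + Real.pi ≤ 4 + Real.sqrt 2 := by
  have h1 : Real.sqrt (8 / 3) ≤ 1.7 := Real.sqrt_le_iff.2 ⟨by norm_num, by norm_num⟩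
  have h2 : 1.4 ≤ Real.sqrt 2 := Real.le_sqrt_of_sq_le (by norm_num)
  linarith [Real.pi_lt_d2]

/-- Project x onto the good set: the projection v contributes the first entry of the maximum, with
factor √(8/3), and x - v the second, with factor π. The radius was chosen so that the 1/θ here
matches the cone estimate. -/
theorem noise_le {X : Matrix (Fin n) (Fin p) ℝ} {s : ℕ} (hn : 0 < n)
    (hs : 1 ≤ s) (hsp : s ≤ p) {σ θ lam : ℝ} (hσ : 0 < σ) (hθ : 0 < θ)
    (hlam : 2 * (4 + Real.sqrt 2) * σ *
      Real.sqrt (Real.log (2 * Real.exp 1 * p / s) / n) ≤ lam)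
    {x : EuclideanSpace ℝ (Fin n)}
    (hx : Metric.infDist x (subgaussianSet (columnForm X) (σ * Real.sqrt n)) ≤
      Real.pi * σ * Real.sqrt (s / θ ^ 2 * Real.log (2 * Real.exp 1 * p / s)))
    (hne : (subgaussianSet (columnForm X) (σ * Real.sqrt n)).Nonempty)
    (u : Fin p → ℝ) {T : Finset (Fin p)} (hT : T.card = s) :
    2 * (1 / n * ∑ i, x i * (X *ᵥ u) i) ≤
      lam * max (Real.sqrt s * Real.sqrt (∑ j, u j ^ 2) + ∑ j ∈ Tᶜ, |u j|)
        (Real.sqrt s / θ * empNorm (X *ᵥ u)) := by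
  have hpi := Real.pi_pos
  have hn' : (0 : ℝ) < n := by exact_mod_cast hn
  have hsn : 0 < Real.sqrt n := Real.sqrt_pos.2 hn'
  set Λ := Real.log (2 * Real.exp 1 * p / s) with hΛ
  set N := Real.sqrt s * Real.sqrt (∑ j, u j ^ 2) + ∑ j ∈ Tᶜ, |u j| with hN
  set D := Real.sqrt s / θ * empNorm (X *ᵥ u) with hD
  obtain ⟨v, hv, hvd⟩ := (isClosed_subgaussianSet (columnForm X)
    (σ * Real.sqrt n)).exists_infDist_eq_dist hne x
  rw [hvd, dist_eq_norm, Real.sqrt_mul (by positivity), Real.sqrt_div (by positivity),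
    Real.sqrt_sq hθ.le] at hx
  have h1 := sum_mul_mulVec_le_of_mem_subgaussianSet hs hsp (mul_pos hσ hsn) hv u hT
  have h2 := sum_mul_le_norm_mul_empNorm hn (x - v) (X *ᵥ u)
  have hE : 0 ≤ empNorm (X *ᵥ u) := Real.sqrt_nonneg _
  have hN0 : 0 ≤ max N D := le_max_of_le_right (by positivity)
  have e : ∑ i, x i * (X *ᵥ u) i = ∑ i, v i * (X *ᵥ u) i + ∑ i, (x - v) i * (X *ᵥ u) i := by
    rw [← Finset.sum_add_distrib]
    exact Finset.sum_congr rfl fun i _ => by simp; ring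
  have h3 : ∑ i, (x - v) i * (X *ᵥ u) i ≤
      Real.pi * (σ * Real.sqrt n) * Real.sqrt Λ * D := by
    refine h2.trans ?_
    calc Real.sqrt n * (‖x - v‖ * empNorm (X *ᵥ u)) ≤
        Real.sqrt n * (Real.pi * σ * (Real.sqrt s / θ * Real.sqrt Λ) * empNorm (X *ᵥ u)) := by
          gcongr
      _ = _ := by rw [hD]; ring
  have h4 : ∑ i, x i * (X *ᵥ u) i ≤
      (4 + Real.sqrt 2) * ((σ * Real.sqrt n) * Real.sqrt Λ) * max N D := by
    have h5 : ∑ i, v i * (X *ᵥ u) i ≤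
        Real.sqrt (8 / 3) * (σ * Real.sqrt n) * Real.sqrt Λ * max N D :=
      h1.trans (by gcongr; exact le_max_left _ _)
    have h6 : Real.pi * (σ * Real.sqrt n) * Real.sqrt Λ * D ≤
        Real.pi * (σ * Real.sqrt n) * Real.sqrt Λ * max N D := by gcongr; exact le_max_right _ _
    have h7 : (Real.sqrt (8 / 3) + Real.pi) * ((σ * Real.sqrt n) * Real.sqrt Λ * max N D) ≤
        (4 + Real.sqrt 2) * ((σ * Real.sqrt n) * Real.sqrt Λ * max N D) :=
      mul_le_mul_of_nonneg_right sqrt_eight_thirds_add_pi_le (by positivity)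
    rw [e]
    linarith
  calc 2 * (1 / n * ∑ i, x i * (X *ᵥ u) i) ≤
      2 * (1 / n * ((4 + Real.sqrt 2) * ((σ * Real.sqrt n) * Real.sqrt Λ) * max N D)) := by gcongr
    _ = 2 * (4 + Real.sqrt 2) * σ * Real.sqrt (Λ / n) * max N D := by
        rw [Real.sqrt_div' _ hn'.le]
        field_simp
        rw [Real.sq_sqrt hn'.le]
    _ ≤ _ := mul_le_mul_of_nonneg_right hlam hN0

end Noise

/-! ### Oracle inequality and estimation bounds -/

section Main

variable {n p : ℕ}

theorem IsLasso.oracle_dichotomy {X : Matrix (Fin n) (Fin p) ℝ} {s : ℕ}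
    (hsp : s ≤ p) (hθ : 0 < sreTheta X s 7) {lam : ℝ} (hlam : 0 ≤ lam) {f x : Fin n → ℝ}
    (hnoise : ∀ (u : Fin p → ℝ) (T : Finset (Fin p)), T.card = s →
      2 * (1 / n * ∑ i, x i * (X *ᵥ u) i) ≤
        lam * max (Real.sqrt s * Real.sqrt (∑ j, u j ^ 2) + ∑ j ∈ Tᶜ, |u j|)
          (Real.sqrt s / sreTheta X s 7 * empNorm (X *ᵥ u)))
    {βh β : Fin p → ℝ} (h : IsLasso X lam (fun i => f i + x i) βh) (hβ : hammingNorm β ≤ s) :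
    ∃ Δ : ℝ, lam / 2 * lqNorm 1 (βh - β) + empNorm (X *ᵥ βh - f) ^ 2 ≤
        empNorm (X *ᵥ β - f) ^ 2 - empNorm (X *ᵥ (βh - β)) ^ 2 + Δ ∧
      ((Real.sqrt s * lqNorm 2 (βh - β) ≤
          Real.sqrt s / sreTheta X s 7 * empNorm (X *ᵥ (βh - β)) ∧
        Δ ≤ 7 / 2 * lam * (Real.sqrt s / sreTheta X s 7 * empNorm (X *ᵥ (βh - β)))) ∨ Δ ≤ 0) := by
  set u := βh - β with hu
  -- The same T, the s largest entries of |u|, serves both the noise bound and the penalty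
  -- difference.
  obtain ⟨T, τ, hT, h0, h1, h2⟩ := exists_card_eq_threshold (h := fun j => |u j|)
    (fun _ => abs_nonneg _) (s := s) (by simpa using hsp)
  have hbasic := h.basic_inequality hlam β
  have hn := hnoise u T hT
  have hsub := lqNorm_one_sub_le h0 h1 h2 (hT ▸ hβ)
  have hu1 : lqNorm 1 u = ∑ i ∈ T, |u i| + ∑ i ∈ Tᶜ, |u i| := by
    rw [lqNorm_one, Finset.sum_add_sum_compl]
  have hA : ∑ i ∈ T, |u i| ≤ Real.sqrt s * lqNorm 2 u := by
    have hcs := Real.sum_mul_le_sqrt_mul_sqrt T (fun _ => (1 : ℝ)) fun i => |u i|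
    simp only [one_mul, one_pow, sq_abs, Finset.sum_const, hT, nsmul_eq_mul, mul_one] at hcs
    refine hcs.trans ?_
    rw [lqNorm_two]
    gcongr
    exact Finset.subset_univ T
  have hrem := lasso_remainder_le (A := ∑ i ∈ T, |u i|) (B := ∑ i ∈ Tᶜ, |u i|)
    (M := Real.sqrt s * lqNorm 2 u) (Z := empNorm (X *ᵥ u)) (r := Real.sqrt s) hA
    (Finset.sum_nonneg fun _ _ => abs_nonneg _) hlam hθ (fun hc => by
      have := sreTheta_mul_le (X := X) (s := s) (c := 7) (δ := u) (by rw [hu1]; linarith)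
      have := mul_le_mul_of_nonneg_left this (Real.sqrt_nonneg s)
      linarith)
  refine ⟨_, ?_, hrem⟩
  rw [lqNorm_two, hu1]
  have := mul_le_mul_of_nonneg_left hsub (show 0 ≤ 2 * lam by linarith)
  linarith

theorem IsLasso.prediction_bound {X : Matrix (Fin n) (Fin p) ℝ} {s : ℕ}
    (hsp : s ≤ p) (hθ : 0 < sreTheta X s 7) {lam : ℝ} (hlam : 0 ≤ lam) {f x : Fin n → ℝ}
    (hnoise : ∀ (u : Fin p → ℝ) (T : Finset (Fin p)), T.card = s →
      2 * (1 / n * ∑ i, x i * (X *ᵥ u) i) ≤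
        lam * max (Real.sqrt s * Real.sqrt (∑ j, u j ^ 2) + ∑ j ∈ Tᶜ, |u j|)
          (Real.sqrt s / sreTheta X s 7 * empNorm (X *ᵥ u)))
    {βh β : Fin p → ℝ} (h : IsLasso X lam (fun i => f i + x i) βh) (hβ : hammingNorm β ≤ s) :
    lam / 2 * lqNorm 1 (βh - β) + empNorm (X *ᵥ βh - f) ^ 2 ≤
      empNorm (X *ᵥ β - f) ^ 2 + 49 * lam ^ 2 * s / (16 * sreTheta X s 7 ^ 2) := by
  obtain ⟨Δ, h1, h2⟩ := h.oracle_dichotomy hsp hθ hlam hnoise hβ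
  set Z := empNorm (X *ᵥ (βh - β))
  set θ := sreTheta X s 7
  have e : 49 * lam ^ 2 * s / (16 * θ ^ 2) = (7 / 4 * lam * (Real.sqrt s / θ)) ^ 2 := by
    rw [mul_pow, div_pow, Real.sq_sqrt (Nat.cast_nonneg s)]
    field_simp; ring
  rw [e]
  rcases h2 with ⟨-, h2⟩ | h2
  -- Complete the square: 2bZ - Z² ≤ b² with b = (7/4)λ√s/θ.
  · nlinarith [sq_nonneg (7 / 4 * lam * (Real.sqrt s / θ) - Z)]
  · nlinarith [sq_nonneg (7 / 4 * lam * (Real.sqrt s / θ)), sq_nonneg Z]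

theorem IsLasso.estimation_bound {X : Matrix (Fin n) (Fin p) ℝ} {s : ℕ} (hs : 1 ≤ s)
    (hsp : s ≤ p) (hθ : 0 < sreTheta X s 7) {lam : ℝ} (hlam : 0 < lam) {x : Fin n → ℝ}
    (hnoise : ∀ (u : Fin p → ℝ) (T : Finset (Fin p)), T.card = s →
      2 * (1 / n * ∑ i, x i * (X *ᵥ u) i) ≤
        lam * max (Real.sqrt s * Real.sqrt (∑ j, u j ^ 2) + ∑ j ∈ Tᶜ, |u j|)
          (Real.sqrt s / sreTheta X s 7 * empNorm (X *ᵥ u)))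
    {βh β : Fin p → ℝ} (h : IsLasso X lam (fun i => (X *ᵥ β) i + x i) βh)
    (hβ : hammingNorm β ≤ s) {q : ℝ} (hq1 : 1 ≤ q) (hq2 : q ≤ 2) :
    lqNorm q (βh - β) ≤ 49 * lam * (s : ℝ) ^ (1 / q) / (8 * sreTheta X s 7 ^ 2) := by
  have hs0 : (0 : ℝ) < s := by exact_mod_cast hs
  have hss : 0 < Real.sqrt s := Real.sqrt_pos.2 hs0
  obtain ⟨Δ, h1, h2⟩ := h.oracle_dichotomy hsp hθ hlam.le hnoise hβ
  have hpred := h.prediction_bound hsp hθ hlam.le hnoise hβ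
  rw [← Matrix.mulVec_sub, sub_self, show empNorm (0 : Fin n → ℝ) = 0 by simp [empNorm]]
    at h1 hpred
  set u := βh - β with hu
  set Z := empNorm (X *ᵥ u) with hZ
  set θ := sreTheta X s 7 with hθd
  have hZ0 : 0 ≤ Z := Real.sqrt_nonneg _
  set C := 49 * lam / (8 * θ ^ 2) with hC
  have hC0 : 0 < C := by positivity
  have hb1 : ∑ j, |u j| ≤ C * s := by
    rw [← lqNorm_one]
    have e : 49 * lam ^ 2 * s / (16 * θ ^ 2) = lam / 2 * (C * s) := by
      rw [hC]; field_simp; ring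
    rw [e] at hpred
    exact le_of_mul_le_mul_left (by nlinarith : lam / 2 * lqNorm 1 u ≤ lam / 2 * (C * s))
      (by positivity)
  have hl1 : 0 ≤ lqNorm 1 u := by
    rw [lqNorm_one]; exact Finset.sum_nonneg fun _ _ => abs_nonneg _
  have hb2 : ∑ j, u j ^ 2 ≤ C ^ 2 * s := by
    rcases h2 with ⟨hM, hΔ⟩ | hΔ
    · have hkey : 2 * Z ^ 2 ≤ 7 / 2 * lam * (Real.sqrt s / θ * Z) := by
        nlinarith [mul_nonneg hlam.le hl1]
      have hZle : Z ≤ 7 / 4 * lam * (Real.sqrt s / θ) := by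
        rcases hZ0.eq_or_lt with h0 | h0
        · rw [← h0]; positivity
        · exact le_of_mul_le_mul_right (by nlinarith :
            Z * Z ≤ 7 / 4 * lam * (Real.sqrt s / θ) * Z) h0
      have h2u : lqNorm 2 u ≤ C * Real.sqrt s := by
        have h3 : Real.sqrt s * lqNorm 2 u ≤ Real.sqrt s * (Z / θ) := by
          refine hM.trans_eq (by ring)
        refine (le_of_mul_le_mul_left h3 hss).trans ?_
        calc Z / θ ≤ 7 / 4 * lam * (Real.sqrt s / θ) / θ := by gcongr
          _ = 2 / 7 * (C * Real.sqrt s) := by rw [hC]; field_simp; ring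
          _ ≤ C * Real.sqrt s := by nlinarith [mul_pos hC0 hss]
      rw [lqNorm_two, Real.sqrt_le_iff] at h2u
      have := h2u.2
      rwa [mul_pow, Real.sq_sqrt hs0.le] at this
    -- A nonpositive remainder leaves nothing to bound |u|_1 from above but 0, so u = 0.
    · have hz : lqNorm 1 u ≤ 0 := by
        by_contra hpos
        have := mul_pos (half_pos hlam) (not_le.1 hpos)
        nlinarith [sq_nonneg Z]
      rw [lqNorm_one] at hz
      have hz0 : ∀ j, u j = 0 := fun j => abs_eq_zero.1 (le_antisymm
        ((Finset.single_le_sum (fun i _ => abs_nonneg (u i)) (Finset.mem_univ j)).trans hz)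
        (abs_nonneg _))
      simp only [hz0]
      simp
      positivity
  refine (lqNorm_le_of_sum_le hC0 hs0.le hq1 hq2 hb1 hb2).trans_eq ?_
  rw [hC]; ring

/-- Every almost everywhere measurable preimage of a measurable set contains a measurable set of
the same measure. -/
theorem exists_measurableSet_subset_preimage {Ω E : Type*} [MeasurableSpace Ω] [MeasurableSpace E]
    {P : Measure Ω} {ν : Measure E} {ξ : Ω → E} (hξ : HasLaw ξ ν P) {B : Set E}
    (hB : MeasurableSet B) :
    ∃ A : Set Ω, MeasurableSet A ∧ P.real A = ν.real B ∧ ∀ ω ∈ A, ξ ω ∈ B := by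
  obtain ⟨A, hAB, hA, hAe⟩ :=
    (hξ.aemeasurable.nullMeasurable hB).exists_measurable_subset_ae_eq
  refine ⟨A, hA, ?_, fun ω hω => hAB hω⟩
  rw [measureReal_congr hAe]
  exact hξ.measureReal_eq hB

end Main

theorem mainTheorem4 {Ω : Type*} [MeasurableSpace Ω] (P : Measure Ω) [IsProbabilityMeasure P]
    (n p s : ℕ) (hs : 1 ≤ s) (hsp : s ≤ p)
    (σ : ℝ) (hσ : 0 < σ)
    (X : Matrix (Fin n) (Fin p) ℝ) (hX : SRE X s 7)
    (ξ : Ω → EuclideanSpace ℝ (Fin n))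
    (hξ : HasLaw ξ (multivariateGaussian 0 (σ ^ 2 • (1 : Matrix (Fin n) (Fin n) ℝ))) P)
    (lam : ℝ)
    (hlam : 2 * (4 + Real.sqrt 2) * σ *
      Real.sqrt (Real.log (2 * Real.exp 1 * p / s) / n) ≤ lam) :
    ∃ A : Set Ω, MeasurableSet A ∧
      1 - 1 / 2 * ((s : ℝ) / (2 * Real.exp 1 * p)) ^ ((s : ℝ) / sreTheta X s 7 ^ 2) ≤ P.real A ∧
      ∀ ω ∈ A, ∀ (f : Fin n → ℝ) (βh : Fin p → ℝ),
        IsLasso X lam (fun i => f i + ξ ω i) βh →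
          (∀ β : Fin p → ℝ, hammingNorm β ≤ s →
            lam / 2 * lqNorm 1 (βh - β) + empNorm (X *ᵥ βh - f) ^ 2 ≤
              empNorm (X *ᵥ β - f) ^ 2 + 49 * lam ^ 2 * s / (16 * sreTheta X s 7 ^ 2)) ∧
          (∀ βs : Fin p → ℝ, hammingNorm βs ≤ s → f = X *ᵥ βs →
            ∀ q : ℝ, 1 ≤ q → q ≤ 2 →
              lqNorm q (βh - βs) ≤
                49 * lam * (s : ℝ) ^ (1 / q) / (8 * sreTheta X s 7 ^ 2)) := by
  have hθ := hX.2
  have hp : 0 < p := by omega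
  have hs1 : (1 : ℝ) ≤ s := by exact_mod_cast hs
  have hs0 : (0 : ℝ) < s := by linarith
  have hp0 : (0 : ℝ) < p := by exact_mod_cast hp
  have hsp' : (s : ℝ) ≤ p := by exact_mod_cast hsp
  have he : (2 : ℝ) ≤ Real.exp 1 := by linarith [Real.add_one_le_exp 1]
  have hθle := sreTheta_le_empNorm_single X hs (show (0 : ℝ) ≤ 7 by norm_num) ⟨0, hp⟩
  have hθ1 : sreTheta X s 7 ≤ 1 := hθle.trans (hX.1 _)
  have hn : 0 < n := by
    rcases Nat.eq_zero_or_pos n with rfl | hn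
    · simp [empNorm] at hθle
      linarith
    · exact hn
  have : Nonempty (Fin p) := ⟨⟨0, hp⟩⟩
  have hn' : (0 : ℝ) < n := by exact_mod_cast hn
  set θ := sreTheta X s 7 with hθd
  set Λ := Real.log (2 * Real.exp 1 * p / s) with hΛ
  have hratio : 2 * Real.exp 1 ≤ 2 * Real.exp 1 * p / s := by
    rw [le_div_iff₀ hs0]; gcongr
  have hΛge : Real.log (2 * Real.exp 1) ≤ Λ := Real.log_le_log (by positivity) hratio
  have hΛ0 : 0 < Λ := (Real.log_pos (by linarith)).trans_le hΛge
  have hlam0 : 0 < lam := lt_of_lt_of_le (by positivity) hlam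
  -- This keeps l = (s/θ²)Λ above log(2e), as the probability bound requires.
  have hsθ : 1 ≤ s / θ ^ 2 := by
    rw [le_div_iff₀ (by positivity), one_mul]
    exact (pow_le_one₀ hθ.le hθ1).trans hs1
  have hl : Real.log (2 * Real.exp 1) ≤ s / θ ^ 2 * Λ := by nlinarith
  set ν := multivariateGaussian (0 : EuclideanSpace ℝ (Fin n))
    (σ ^ 2 • (1 : Matrix (Fin n) (Fin n) ℝ)) with hν
  have hν0 : ν[id] = 0 := integral_id_multivariateGaussian'
  have hvar : ∀ L : StrongDual ℝ (EuclideanSpace ℝ (Fin n)), Var[L; ν] ≤ σ ^ 2 * ‖L‖ ^ 2 :=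
    fun L => (variance_multivariateGaussian_smul_one L).le
  set τ := σ * Real.sqrt n with hτd
  have hτ : 0 < τ := mul_pos hσ (Real.sqrt_pos.2 hn')
  have hcol : ∀ j, Var[columnForm X j; ν] ≤ τ ^ 2 := fun j => by
    rw [hτd, mul_pow, Real.sq_sqrt hn'.le]
    exact (hvar _).trans (by gcongr; exact norm_columnForm_sq_le X hn (hX.1 j))
  have hne : (subgaussianSet (columnForm X) τ).Nonempty := by
    rw [Set.nonempty_iff_ne_empty]
    intro hempty
    have := half_le_measure_subgaussianSet hν0 hτ hcol
    simp [hempty] at this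
  have hprob := measureReal_infDist_subgaussianSet_le hν0 hσ hvar hτ hcol hl
  obtain ⟨A, hA, hAP, hAξ⟩ := exists_measurableSet_subset_preimage hξ
    (isClosed_le (Metric.continuous_infDist_pt (subgaussianSet (columnForm X) τ))
      (continuous_const (y := Real.pi * σ * Real.sqrt (s / θ ^ 2 * Λ)))).measurableSet
  refine ⟨A, hA, ?_, fun ω hω f βh hLasso => ?_⟩
  · rw [hAP]
    refine le_of_eq_of_le ?_ hprob
    congr 2
    rw [Real.rpow_def_of_pos (by positivity), ← inv_div, Real.log_inv, neg_mul, mul_comm]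
  · have hnoise : ∀ (u : Fin p → ℝ) (T : Finset (Fin p)), T.card = s →
        2 * (1 / n * ∑ i, ξ ω i * (X *ᵥ u) i) ≤
          lam * max (Real.sqrt s * Real.sqrt (∑ j, u j ^ 2) + ∑ j ∈ Tᶜ, |u j|)
            (Real.sqrt s / θ * empNorm (X *ᵥ u)) := fun u T hT =>
      noise_le hn hs hsp hσ hθ hlam (hAξ ω hω) hne u hT
    refine ⟨fun β hβ => hLasso.prediction_bound hsp hθ hlam0.le hnoise hβ, ?_⟩
    rintro βs hβs rfl q hq1 hq2
    exact hLasso.estimation_bound hs hsp hθ hlam0 hnoise hβs hq1 hq2
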